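/- Let $q$ be an odd prime power. An $(m\times k)$-system over $\mathbb F_q$ is a system $L$ of $m$ homogeneous linear forms in $k$ variables with coefficients in $\mathbb F_q$ whose coefficient matrix has linearly independent rows. A $k$-variable system $L$ *induces* an $\ell$-variable system $L'$ if there are distinct indices $i_1,\dots,i_\ell\in\{1,\dots,k\}$ such that, for all $x\in\mathbb F_q^k$, $L(x_1,\dots,x_k)=0$ implies $L'(x_{i_1},\dots,x_{i_\ell})=0$. $L$ is *irredundant* if it induces no equation $x_i-x_j=0$ with $i\neq j$. For $\ell\ge 3$, the $\ell$-term arithmetic progression ($\ell$-AP) is the system $x_r-2x_{r+1}+x_{r+2}=0$, $1\le r\le \ell-2$. For $A\subseteq\mathbb F_q^n$ let $\mathrm{sol}(L;A)$ be the set of $(x_1,\dots,x_k)\in A^k$ with $L(x_1,\dots,x_k)=0$, and let $\mu_L(A)=\big(|\mathrm{sol}(L;A)|+|\mathrm{sol}(L;\mathbb F_q^n\setminus A)|\big)/|\mathrm{sol}(L;\mathbb F_q^n)|$ be the density of monochromatic solutions in the two-colouring $(A,\mathbb F_q^n\setminus A)$. Let $\mathbb E_n(L)$ be the expectation of $\mu_L(A)$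 for a uniformly random subset $A\subseteq\mathbb F_q^n$. $L$ is *common* if for every $\varepsilon>0$ there is $N$ such that $\mu_L(A)\ge \mathbb E_n(L)-\varepsilon$ for all $n\ge N$ and all $A\subseteq\mathbb F_q^n$; otherwise $L$ is *uncommon*. 1. Let $2\le m<k$. Every irredundant $(m\times k)$-system over $\mathbb F_q$ that induces a $4$-AP is uncommon. 2. Let $2\le m<k$ and $\ell\ge 4$. Every irredundant $(m\times k)$-system over $\mathbb F_q$ that induces an $\ell$-AP is uncommon. 3. If the characteristic of $\mathbb F_q$ is not $3$, then for every $\ell\ge 4$ the $\ell$-AP over $\mathbb F_q$ is itself uncommon. -/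

import Mathlib

namespace LinSystem

variable {F : Type*} [Field F]

/-- The coefficient matrix `L` represents an `(m × k)`-system: its rows are linearly independent. -/
def IsSystem {m k : ℕ} (L : Matrix (Fin m) (Fin k) F) : Prop :=
  LinearIndependent F (fun r : Fin m => L r)

/-- `L` induces the `ℓ`-variable system `L'` as a subsystem: for some choice of `ℓ` distinct
variables `x_{i 0}, …, x_{i (ℓ-1)}` of `L`, every solution of `L` restricts to a solution of `L'`. -/
def Induces {m k m' l : ℕ} (L : Matrix (Fin m) (Fin k) F) (L' : Matrix (Fin m') (Fin l) F) : Prop :=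
  ∃ i : Fin l ↪ Fin k, ∀ x : Fin k → F, L.mulVec x = 0 → L'.mulVec (fun t => x (i t)) = 0

/-- `L` is redundant if it induces an equation `x_i - x_j = 0` with `i ≠ j`. -/
def Redundant {m k : ℕ} (L : Matrix (Fin m) (Fin k) F) : Prop :=
  ∃ i j : Fin k, i ≠ j ∧ ∀ x : Fin k → F, L.mulVec x = 0 → x i - x j = 0

/-- `L` is irredundant if it is not redundant. -/
def Irredundant {m k : ℕ} (L : Matrix (Fin m) (Fin k) F) : Prop :=
  ¬ Redundant L

/-- The system of an arithmetic progression of length `l` (used for `l ≥ 2`): the `l - 2` equations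
`x_r - 2 x_{r+1} + x_{r+2} = 0`. -/
def apSystem (F : Type*) [Field F] (l : ℕ) : Matrix (Fin (l - 2)) (Fin l) F :=
  Matrix.of fun r c =>
    if c.val = r.val then 1
    else if c.val = r.val + 1 then -2
    else if c.val = r.val + 2 then 1
    else 0

variable [Fintype F] [DecidableEq F]

/-- The solutions `(x_1, …, x_k)` of `L` with all `x_i` in the set `A` of vectors of `F^n`. -/
def sol {m k n : ℕ} (L : Matrix (Fin m) (Fin k) F) (A : Finset (Fin n → F)) :
    Finset (Fin k → Fin n → F) :=
  Finset.univ.filter fun x => (∀ i, x i ∈ A) ∧ ∀ r : Fin m, ∑ i, L r i • x i = 0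

/-- The density, among all solutions of `L` in `F^n`, of those that are monochromatic in the
two-colouring `(A, Aᶜ)` of `F^n`. -/
noncomputable def monoDensity {m k n : ℕ} (L : Matrix (Fin m) (Fin k) F)
    (A : Finset (Fin n → F)) : ℝ :=
  (((sol L A).card : ℝ) + ((sol L Aᶜ).card : ℝ)) /
    ((sol L (Finset.univ : Finset (Fin n → F))).card : ℝ)

/-- The expected density of monochromatic solutions of `L` in a random two-colouring of `F^n`
(each vector gets one of the two colours independently with probability `1/2`, so that the colour
class `A` is a uniformly random subset of `F^n`). -/
noncomputable def expectedMonoDensity {m k : ℕ} (L : Matrix (Fin m) (Fin k) F) (n : ℕ) : ℝ :=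
  (∑ A : Finset (Fin n → F), monoDensity L A) / (Fintype.card (Finset (Fin n → F)) : ℝ)

/-- `L` is common: in every two-colouring of `F^n` the density of monochromatic solutions is
asymptotically (as `n → ∞`) at least its expectation in a random two-colouring. -/
def Common {m k : ℕ} (L : Matrix (Fin m) (Fin k) F) : Prop :=
  ∀ ε : ℝ, 0 < ε → ∃ N : ℕ, ∀ n : ℕ, N ≤ n → ∀ A : Finset (Fin n → F),
    expectedMonoDensity L n - ε ≤ monoDensity L A

/-- `L` is uncommon if it is not common. -/
def Uncommon {m k : ℕ} (L : Matrix (Fin m) (Fin k) F) : Prop :=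
  ¬ Common L

end LinSystem

/-! Parametrise the solutions of the system by a finite vector space `W`, so that the distinct
variables become distinct linear forms `φ i` on `W`. A random set in which `x` is included with
probability `(1 + f x) / 2` has expected monochromatic density `2 ^ (-|ι|)` times the average of `∏
(1 + f (φ i y)) + ∏ (1 - f (φ i y))`, up to degenerate solutions. A uniformly random set yields at
least `2 * 2 ^ (-|ι|)`, so an `f` for which the average is below `2` shows that the system is
uncommon (`Represents.uncommon`). In the expansion of the products only even subsets of forms
survive. Replacing `f` by a small multiple of itself makes the least relevant size dominate, so it
suffices that the correlations of smaller even size vanish and those of size `d` have negative sum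
(`Represents.uncommon_of_tendsto`).

If some form is zero, or two forms are proportional, simple functions `f` work
(`Represents.uncommon_of_eq_zero`, `Represents.uncommon_of_eq_smul`, the latter with `d = 2`).
Otherwise the forms are pairwise independent and `d = 4`. The function `chirp` combines quadratic
phases of frequencies `±1, ±3, ±3, ±1`, placed at the points `(1, 0), …, (1, 3)`, with coefficients
of signs `+, +, -, +`. In the limit a choice of terms of `chirp`, one for each form, contributes
only if its quadratic phases cancel identically. For two independent forms this is impossible. For
four, cancellation forces the four points to be distinct
(`injective_fst_of_sum_chirpFreq_mul_sq_eq_zero`), so every contribution carries the product of all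
four coefficients, which is negative. A 4-AP does contribute, by the vanishing third difference `x₀²
- 3x₁² + 3x₂² - x₃² = 0` (`exists_chirpTerm_neg`). -/

namespace LinSystem

/-! ### Random sets with prescribed inclusion probabilities. -/

section Sampling

variable {X : Type*} [Fintype X] [DecidableEq X]

/-- The probability of `A` when each `x` is put into `A` independently with probability `w x`. -/
noncomputable def bernoulliWeight (w : X → ℝ) (A : Finset X) : ℝ :=
  ∏ x, if x ∈ A then w x else 1 - w x

lemma sum_bernoulliWeight_mul_prod (w a b : X → ℝ) :
    ∑ A : Finset X, bernoulliWeight w A * ∏ x, (if x ∈ A then a x else b x) =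
      ∏ x, (w x * a x + (1 - w x) * b x) := by
  rw [Finset.prod_add, Finset.powerset_univ]
  refine Finset.sum_congr rfl fun A _ => ?_
  rw [bernoulliWeight, ← Finset.prod_mul_distrib,
    Finset.prod_congr rfl (g := fun x => if x ∈ A then w x * a x else (1 - w x) * b x)
      (fun x _ => by split_ifs <;> rfl), Finset.prod_ite]
  congr 1
  · simp
  · refine Finset.prod_congr ?_ fun _ _ => rfl
    ext x
    simp

lemma sum_bernoulliWeight (w : X → ℝ) : ∑ A : Finset X, bernoulliWeight w A = 1 := by
  simpa using sum_bernoulliWeight_mul_prod w 1 1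

lemma bernoulliWeight_nonneg {w : X → ℝ} (h0 : ∀ x, 0 ≤ w x) (h1 : ∀ x, w x ≤ 1) (A : Finset X) :
    0 ≤ bernoulliWeight w A :=
  Finset.prod_nonneg fun x _ => by
    split_ifs
    · exact h0 x
    · linarith [h1 x]

lemma sum_bernoulliWeight_subset (w : X → ℝ) (T : Finset X) :
    ∑ A : Finset X, bernoulliWeight w A * (if ∀ x ∈ T, x ∈ A then 1 else 0) = ∏ x ∈ T, w x := by
  have h := sum_bernoulliWeight_mul_prod w 1 (fun x => if x ∈ T then 0 else 1)
  have h2 : ∏ x, (w x * (1 : X → ℝ) x + (1 - w x) * (if x ∈ T then 0 else 1)) = ∏ x ∈ T, w x := by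
    rw [← Finset.prod_subset (Finset.subset_univ T)]
    · exact Finset.prod_congr rfl fun x hx => by simp [hx]
    · intro x _ hx
      simp [hx]
  rw [← h2, ← h]
  refine Finset.sum_congr rfl fun A _ => ?_
  congr 1
  split_ifs with hA
  · refine (Finset.prod_eq_one fun x _ => ?_).symm
    by_cases hx : x ∈ A
    · simp [hx]
    · simp [hx, mt (hA x) hx]
  · push Not at hA
    obtain ⟨x, hx, hxA⟩ := hA
    exact (Finset.prod_eq_zero (Finset.mem_univ x) (by simp [hx, hxA])).symm

lemma sum_bernoulliWeight_disjoint (w : X → ℝ) (T : Finset X) :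
    ∑ A : Finset X, bernoulliWeight w A * (if ∀ x ∈ T, x ∈ Aᶜ then 1 else 0) =
      ∏ x ∈ T, (1 - w x) := by
  rw [← sum_bernoulliWeight_subset]
  refine Fintype.sum_equiv compl_involutive.toPerm _ _ fun A => ?_
  simp only [bernoulliWeight, Function.Involutive.coe_toPerm, Finset.mem_compl, ite_not]
  congr 1
  exact Finset.prod_congr rfl fun x _ => by split_ifs <;> ring

variable {ι Y : Type*} [Fintype ι] [Fintype Y]

/-- First moment method. For `y ∉ B` the points `p i y` are distinct, so independence gives the
products exactly; for `y ∈ B` the two probabilities are each bounded by `1`, whence `2 * B.card`. -/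
lemma exists_finset_card_add_card_le (p : ι → Y → X) {w : X → ℝ} (h0 : ∀ x, 0 ≤ w x)
    (h1 : ∀ x, w x ≤ 1) (B : Finset Y) (hB : ∀ y, y ∉ B → Function.Injective fun i => p i y) :
    ∃ A : Finset X, (({y | ∀ i, p i y ∈ A} : Finset Y).card : ℝ) +
        ({y | ∀ i, p i y ∈ Aᶜ} : Finset Y).card ≤
      ∑ y, (∏ i, w (p i y) + ∏ i, (1 - w (p i y))) + 2 * B.card := by
  classical
  by_contra! hcon
  set R := ∑ y, (∏ i, w (p i y) + ∏ i, (1 - w (p i y))) + 2 * (B.card : ℝ) with hR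
  obtain ⟨A₀, hA₀⟩ : ∃ A, 0 < bernoulliWeight w A := by
    by_contra! h
    have := Finset.sum_nonpos fun A (_ : A ∈ Finset.univ) => h A
    rw [sum_bernoulliWeight] at this
    linarith
  have hlt : ∑ A, bernoulliWeight w A * R <
      ∑ A, bernoulliWeight w A * ((({y | ∀ i, p i y ∈ A} : Finset Y).card : ℝ) +
        ({y | ∀ i, p i y ∈ Aᶜ} : Finset Y).card) :=
    Finset.sum_lt_sum
      (fun A _ => mul_le_mul_of_nonneg_left (hcon A).le (bernoulliWeight_nonneg h0 h1 A))
      ⟨A₀, Finset.mem_univ _, mul_lt_mul_of_pos_left (hcon A₀) hA₀⟩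
  rw [← Finset.sum_mul, sum_bernoulliWeight, one_mul] at hlt
  have hy : ∀ y, ∑ A, bernoulliWeight w A * ((if ∀ i, p i y ∈ A then (1 : ℝ) else 0) +
      if ∀ i, p i y ∈ Aᶜ then 1 else 0) ≤
      ∏ i, w (p i y) + ∏ i, (1 - w (p i y)) + if y ∈ B then 2 else 0 := by
    intro y
    have e1 := sum_bernoulliWeight_subset w (Finset.univ.image fun i => p i y)
    have e2 := sum_bernoulliWeight_disjoint w (Finset.univ.image fun i => p i y)
    simp only [Finset.mem_image, Finset.mem_univ, true_and, forall_exists_index,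
      forall_apply_eq_imp_iff] at e1 e2
    simp only [mul_add, Finset.sum_add_distrib]
    rw [e1, e2]
    split_ifs with hyB
    · have a1 : ∏ x ∈ Finset.univ.image fun i => p i y, w x ≤ 1 :=
        Finset.prod_le_one (fun x _ => h0 x) fun x _ => h1 x
      have a2 : ∏ x ∈ Finset.univ.image fun i => p i y, (1 - w x) ≤ 1 :=
        Finset.prod_le_one (fun x _ => by linarith [h1 x]) fun x _ => by linarith [h0 x]
      have a3 : 0 ≤ ∏ i, w (p i y) := Finset.prod_nonneg fun i _ => h0 _
      have a4 : 0 ≤ ∏ i, (1 - w (p i y)) :=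
        Finset.prod_nonneg fun i _ => by linarith [h1 (p i y)]
      linarith
    · rw [Finset.prod_image (hB y hyB).injOn, Finset.prod_image (hB y hyB).injOn, add_zero]
  have hsum := Finset.sum_le_sum fun y (_ : y ∈ Finset.univ) => hy y
  rw [Finset.sum_comm, Finset.sum_add_distrib] at hsum
  refine absurd hlt (not_lt.2 ?_)
  convert hsum using 1
  · refine Finset.sum_congr rfl fun A _ => ?_
    rw [← Finset.mul_sum, Finset.sum_add_distrib, Finset.sum_boole, Finset.sum_boole]
  · simp [hR, mul_comm]

/-- Coincidences among the points `p i y` only raise the probability that all have the same colour,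
so no genericity is needed for this direction. -/
lemma two_mul_half_pow_le_average (p : ι → Y → X) :
    2 * (1 / 2 : ℝ) ^ Fintype.card ι * Fintype.card Y ≤
      (∑ A : Finset X, ((({y | ∀ i, p i y ∈ A} : Finset Y).card : ℝ) +
        ({y | ∀ i, p i y ∈ Aᶜ} : Finset Y).card)) / Fintype.card (Finset X) := by
  classical
  have hw : ∀ A : Finset X,
      bernoulliWeight (fun _ => 1 / 2) A = (Fintype.card (Finset X) : ℝ)⁻¹ := by
    intro A
    rw [bernoulliWeight, Finset.prod_congr rfl (g := fun _ => (1 / 2 : ℝ))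
      (fun x _ => by split_ifs <;> norm_num)]
    simp [Fintype.card_finset]
  have hy : ∀ y, 2 * (1 / 2 : ℝ) ^ Fintype.card ι ≤ ∑ A : Finset X,
      bernoulliWeight (fun _ => 1 / 2) A * ((if ∀ i, p i y ∈ A then (1 : ℝ) else 0) +
        if ∀ i, p i y ∈ Aᶜ then 1 else 0) := by
    intro y
    have e1 := sum_bernoulliWeight_subset (fun _ => 1 / 2) (Finset.univ.image fun i => p i y)
    have e2 := sum_bernoulliWeight_disjoint (fun _ => 1 / 2) (Finset.univ.image fun i => p i y)
    simp only [Finset.mem_image, Finset.mem_univ, true_and, forall_exists_index,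
      forall_apply_eq_imp_iff] at e1 e2
    simp only [mul_add, Finset.sum_add_distrib]
    rw [e1, e2, Finset.prod_const, Finset.prod_const]
    have h : (1 / 2 : ℝ) ^ Fintype.card ι ≤
        (1 / 2) ^ (Finset.univ.image fun i => p i y).card :=
      pow_le_pow_of_le_one (by norm_num) (by norm_num) Finset.card_image_le
    norm_num at h ⊢
    linarith
  have hsum := Finset.sum_le_sum fun y (_ : y ∈ Finset.univ) => hy y
  rw [Finset.sum_comm, Finset.sum_const, Finset.card_univ, nsmul_eq_mul] at hsum
  rw [mul_comm]
  refine hsum.trans_eq ?_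
  rw [Finset.sum_div]
  refine Finset.sum_congr rfl fun A _ => ?_
  rw [← Finset.mul_sum, Finset.sum_add_distrib, Finset.sum_boole, Finset.sum_boole, hw,
    div_eq_inv_mul]

end Sampling

/-! ### A functional criterion for being uncommon. -/

section Criterion

variable {F : Type*} [Field F]
variable {ι W : Type*} [Fintype ι] [AddCommGroup W] [Module F W] [Fintype W]

lemma card_filter_apply_eq_zero_mul_two_le [DecidableEq F] {ψ : W →ₗ[F] F} (hψ : ψ ≠ 0) :
    ({w | ψ w = 0} : Finset W).card * 2 ≤ Fintype.card W := by
  classical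
  obtain ⟨w₀, hw₀⟩ : ∃ w, ψ w ≠ 0 := by
    by_contra! h
    exact hψ (LinearMap.ext h)
  have h1 : ({w | ψ w = 0} : Finset W).card ≤ ({w | ¬ ψ w = 0} : Finset W).card :=
    Finset.card_le_card_of_injOn (fun w => w + w₀)
      (fun w hw => by
        have : ψ w = 0 := by simpa using hw
        simp [this, hw₀])
      fun _ _ _ _ h => add_right_cancel h
  have h2 := Finset.card_filter_add_card_filter_not (s := (Finset.univ : Finset W))
    (fun w => ψ w = 0)
  rw [Finset.card_univ] at h2
  omega

lemma card_filter_forall_apply_eq_zero_le [DecidableEq F] {I : Type*} [Fintype I] [DecidableEq I]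
    {ψ : W →ₗ[F] F} (hψ : ψ ≠ 0) :
    (({y | ∀ t, ψ (y t) = 0} : Finset (I → W)).card : ℝ) ≤
      (1 / 2 : ℝ) ^ Fintype.card I * (Fintype.card W : ℝ) ^ Fintype.card I := by
  have h : ({y | ∀ t, ψ (y t) = 0} : Finset (I → W)) =
      Fintype.piFinset fun _ => ({w | ψ w = 0} : Finset W) := by
    ext y
    simp
  rw [h, Fintype.card_piFinset, Finset.prod_const, Finset.card_univ, ← mul_pow, Nat.cast_pow]
  refine pow_le_pow_left₀ (Nat.cast_nonneg _) ?_ _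
  have : ((({w | ψ w = 0} : Finset W).card * 2 : ℕ) : ℝ) ≤ Fintype.card W :=
    Nat.cast_le.2 (card_filter_apply_eq_zero_mul_two_le hψ)
  push_cast at this
  linarith

/-- Union bound over pairs: two distinct forms agree on at most half of `W`, hence in all
coordinates with proportion at most `2 ^ (-|I|)`. -/
lemma exists_finset_forall_notMem_injective {φ : ι → W →ₗ[F] F} (hφ : Function.Injective φ)
    {I : Type*} [Fintype I] [DecidableEq I] :
    ∃ B : Finset (I → W), (B.card : ℝ) ≤ (Fintype.card ι : ℝ) ^ 2 * (1 / 2) ^ Fintype.card I *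
        (Fintype.card W : ℝ) ^ Fintype.card I ∧
      ∀ y, y ∉ B → Function.Injective fun i t => φ i (y t) := by
  classical
  let Z : ι × ι → Finset (I → W) := fun ij => {y | ∀ t, (φ ij.1 - φ ij.2) (y t) = 0}
  have hZ : ∀ ij ∈ (Finset.univ.offDiag : Finset (ι × ι)), ((Z ij).card : ℝ) ≤
      (1 / 2) ^ Fintype.card I * (Fintype.card W : ℝ) ^ Fintype.card I := fun ij hij =>
by
    have hne : φ ij.1 - φ ij.2 ≠ 0 :=
      sub_ne_zero.2 (hφ.ne (Finset.mem_offDiag.1 hij).2.2)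
    have := card_filter_forall_apply_eq_zero_le (I := I) hne
    convert this using 3
  refine ⟨Finset.univ.offDiag.biUnion Z, ?_, fun y hy i j hij => ?_⟩
  · have h1 : ((Finset.univ.offDiag.biUnion Z).card : ℝ) ≤
        ∑ ij ∈ (Finset.univ.offDiag : Finset (ι × ι)), ((Z ij).card : ℝ) := by
      exact_mod_cast Finset.card_biUnion_le
    have h2 := Finset.sum_le_sum hZ
    rw [Finset.sum_const, nsmul_eq_mul] at h2
    have h3 : ((Finset.univ.offDiag : Finset (ι × ι)).card : ℝ) ≤ (Fintype.card ι : ℝ) ^ 2 := by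
      rw [Finset.offDiag_card, Finset.card_univ, sq]
      exact_mod_cast Nat.sub_le _ _
    rw [mul_assoc]
    exact (h1.trans h2).trans (mul_le_mul_of_nonneg_right h3 (by positivity))
  · by_contra hne
    refine hy (Finset.mem_biUnion.2 ⟨(i, j), by simpa using hne, ?_⟩)
    simpa [Z, sub_eq_zero] using fun t => congrFun hij t

variable [Fintype F] [DecidableEq F]

/-- The solutions of `L` in `F^n` correspond to the families `(φ i (y 1), …, φ i (y n))`,
`y ∈ W^n`, as far as the sets containing them are concerned. -/
def Represents {m k : ℕ} (L : Matrix (Fin m) (Fin k) F) (φ : ι → W →ₗ[F] F) : Prop :=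
  ∀ (n : ℕ) (A : Finset (Fin n → F)),
    (sol L A).card = ({y | ∀ i, (fun t => φ i (y t)) ∈ A} : Finset (Fin n → W)).card

variable {m k : ℕ} {L : Matrix (Fin m) (Fin k) F} {φ : ι → W →ₗ[F] F}

lemma Represents.monoDensity_eq (h : Represents L φ) {n : ℕ} (A : Finset (Fin n → F)) :
    monoDensity L A = ((({y | ∀ i, (fun t => φ i (y t)) ∈ A} : Finset (Fin n → W)).card : ℝ) +
      ({y | ∀ i, (fun t => φ i (y t)) ∈ Aᶜ} : Finset (Fin n → W)).card) /
        (Fintype.card W : ℝ) ^ n := by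
  rw [monoDensity, h, h, h]
  simp

lemma Represents.two_mul_half_pow_le (h : Represents L φ) (n : ℕ) :
    2 * (1 / 2 : ℝ) ^ Fintype.card ι ≤ expectedMonoDensity L n := by
  have hW : (0 : ℝ) < (Fintype.card W : ℝ) ^ n := by
    have : 0 < Fintype.card W := Fintype.card_pos
    positivity
  have := two_mul_half_pow_le_average (fun i (y : Fin n → W) t => φ i (y t))
  simp only [Fintype.card_fun, Fintype.card_fin, Nat.cast_pow] at this
  rw [expectedMonoDensity]
  simp only [h.monoDensity_eq]
  rw [← Finset.sum_div, div_right_comm, le_div_iff₀ hW]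
  exact this

lemma exists_sum_comp_eq (W : Type*) [Fintype W] (I : Type*) [Fintype I] [DecidableEq I] (N : ℕ) :
    ∃ n, n = Fintype.card I + N ∧ ∃ e : I → Fin n, ∀ Φ : (I → W) → ℝ,
      ∑ y : Fin n → W, Φ (fun t => y (e t)) = (Fintype.card W : ℝ) ^ N * ∑ z, Φ z := by
  classical
  let E : I ⊕ Fin N ≃ Fin (Fintype.card I + N) :=
    ((Fintype.equivFin I).sumCongr (Equiv.refl _)).trans finSumFinEquiv
  refine ⟨_, rfl, fun t => E (Sum.inl t), fun Φ => ?_⟩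
  have h := Fintype.sum_equiv ((Equiv.arrowCongr E.symm (Equiv.refl W)).trans
    (Equiv.sumArrowEquivProdArrow I (Fin N) W)) (fun y => Φ fun t => y (E (Sum.inl t)))
    (fun z => Φ z.1) fun y => rfl
  rw [h, Fintype.sum_prod_type]
  simp [Finset.mul_sum]

/-- The function `f` sees only the coordinates in `I`. Extra coordinates leave its averages
unchanged while making degenerate solutions negligible, so the sampled sets beat the random density
by a fixed amount for arbitrarily large `n`. -/
theorem Represents.uncommon (h : Represents L φ) (hφ : Function.Injective φ) {I : Type*}
    [Fintype I] [DecidableEq I] (f : (I → F) → ℝ) (hf : ∀ x, |f x| ≤ 1)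
    (hneg : ∑ y : I → W, (∏ i, (1 + f fun t => φ i (y t)) + ∏ i, (1 - f fun t => φ i (y t))) <
      2 * (Fintype.card W : ℝ) ^ Fintype.card I) : Uncommon L := by
  classical
  intro hcom
  have hW : (0 : ℝ) < Fintype.card W := Nat.cast_pos.2 Fintype.card_pos
  set S := ∑ y : I → W, (∏ i, (1 + f fun t => φ i (y t)) + ∏ i, (1 - f fun t => φ i (y t)))
  set D : ℝ := (1 / 2) ^ Fintype.card ι * (2 - S / (Fintype.card W : ℝ) ^ Fintype.card I) with hD
  have hDpos : 0 < D := by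
    have : S / (Fintype.card W : ℝ) ^ Fintype.card I < 2 := by
      rw [div_lt_iff₀ (by positivity)]
      exact hneg
    have h2 : (0 : ℝ) < (1 / 2) ^ Fintype.card ι := by positivity
    exact mul_pos h2 (by linarith)
  -- `D` is the gain over the random density. One half is set against the `ε` of commonness, the
  -- other against the degenerate solutions.
  obtain ⟨N₀, hN₀⟩ := hcom (D / 2) (by linarith)
  obtain ⟨N₁, hN₁⟩ : ∃ N₁ : ℕ, 2 * ((Fintype.card ι : ℝ) ^ 2 * (1 / 2) ^ N₁) < D / 2 := by
    obtain ⟨N₁, hN₁⟩ := exists_pow_lt_of_lt_one (x := D / (4 * ((Fintype.card ι : ℝ) ^ 2 + 1)))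
      (by positivity) (show (1 / 2 : ℝ) < 1 by norm_num)
    refine ⟨N₁, ?_⟩
    rw [lt_div_iff₀ (by positivity)] at hN₁
    have : (0 : ℝ) < (1 / 2) ^ N₁ := by positivity
    nlinarith
  obtain ⟨n, hn, e, he⟩ := exists_sum_comp_eq W I (N₀ + N₁)
  obtain ⟨B, hBcard, hB⟩ := exists_finset_forall_notMem_injective hφ (I := Fin n)
  rw [Fintype.card_fin] at hBcard
  obtain ⟨A, hA⟩ := exists_finset_card_add_card_le (X := Fin n → F)
    (fun i (y : Fin n → W) t => φ i (y t)) (w := fun x => (1 + f fun t => x (e t)) / 2)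
    (fun x => by linarith [abs_le.1 (hf fun t => x (e t))])
    (fun x => by linarith [abs_le.1 (hf fun t => x (e t))]) B hB
  have hS : ∑ y : Fin n → W, (∏ i, ((1 + f fun t => φ i (y (e t))) / 2) +
      ∏ i, (1 - (1 + f fun t => φ i (y (e t))) / 2)) =
      (1 / 2) ^ Fintype.card ι * ((Fintype.card W : ℝ) ^ (N₀ + N₁) * S) := by
    rw [← he fun z => ∏ i, (1 + f fun t => φ i (z t)) + ∏ i, (1 - f fun t => φ i (z t)),
      Finset.mul_sum]
    refine Finset.sum_congr rfl fun y _ => ?_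
    have e1 : ∀ c : ℝ, 1 - (1 + c) / 2 = 1 / 2 * (1 - c) := fun c => by ring
    have e2 : ∀ c : ℝ, (1 + c) / 2 = 1 / 2 * (1 + c) := fun c => by ring
    simp only [e1]
    simp only [e2]
    rw [Finset.prod_mul_distrib, Finset.prod_mul_distrib, Finset.prod_const, Finset.card_univ]
    ring
  rw [hS] at hA
  have hpow : (1 / 2 : ℝ) ^ n ≤ (1 / 2) ^ N₁ :=
    pow_le_pow_of_le_one (by norm_num) (by norm_num) (by omega)
  have h1 := hN₀ n (by omega) A
  have h2 := h.two_mul_half_pow_le n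
  have h3 : monoDensity L A ≤
      (1 / 2) ^ Fintype.card ι * (S / (Fintype.card W : ℝ) ^ Fintype.card I) +
        2 * ((Fintype.card ι : ℝ) ^ 2 * (1 / 2) ^ N₁) := by
    rw [h.monoDensity_eq, div_le_iff₀ (by positivity)]
    refine hA.trans ?_
    have : (1 / 2) ^ Fintype.card ι * (S / (Fintype.card W : ℝ) ^ Fintype.card I) *
        (Fintype.card W : ℝ) ^ n =
        (1 / 2) ^ Fintype.card ι * ((Fintype.card W : ℝ) ^ (N₀ + N₁) * S) := by
      rw [hn, pow_add]
      field_simp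
    have h5 : (B.card : ℝ) ≤ (Fintype.card ι : ℝ) ^ 2 * (1 / 2) ^ N₁ * (Fintype.card W : ℝ) ^ n := by
      refine hBcard.trans ?_
      gcongr
    rw [add_mul, this]
    linarith
  have h4 : D = 2 * (1 / 2) ^ Fintype.card ι -
      (1 / 2) ^ Fintype.card ι * (S / (Fintype.card W : ℝ) ^ Fintype.card I) := by
    rw [hD]
    ring
  linarith

lemma prod_one_add_add_prod_one_sub (f : ι → ℝ) :
    ∏ i, (1 + f i) + ∏ i, (1 - f i) =
      2 + 2 * ∑ S : Finset ι with Even S.card ∧ S.Nonempty, ∏ i ∈ S, f i := by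
  classical
  have h : ∀ g : ι → ℝ, ∏ i, (1 + g i) = ∑ S : Finset ι, ∏ i ∈ S, g i := fun g => by
    simp [add_comm (1 : ℝ), Finset.prod_add]
  simp only [sub_eq_add_neg]
  rw [h, h, ← Finset.sum_add_distrib, ← Finset.add_sum_erase _ _ (Finset.mem_univ ∅),
    Finset.mul_sum, Finset.sum_filter]
  congr 1
  · norm_num
  · rw [← Finset.add_sum_erase _ _ (Finset.mem_univ ∅)]
    simp only [Finset.not_nonempty_empty, and_false, if_false, zero_add]
    refine Finset.sum_congr rfl fun S hS => ?_
    have hne : S.Nonempty := Finset.nonempty_iff_ne_empty.2 (Finset.ne_of_mem_erase hS)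
    rw [Finset.prod_neg]
    rcases Nat.even_or_odd S.card with he | ho
    · rw [if_pos ⟨he, hne⟩, he.neg_one_pow]
      ring
    · rw [if_neg fun hh => (Nat.not_even_iff_odd.2 ho) hh.1, ho.neg_one_pow]
      ring

/-- After division by `l ^ d` the sum is continuous in `l`, and its value at `l = 0` is the part of
size `d`. -/
lemma exists_pow_mul_sum_neg {ι : Type*} (𝒮 : Finset (Finset ι)) (τ : Finset ι → ℝ) (d : ℕ)
    (h0 : ∀ S ∈ 𝒮, S.card < d → τ S = 0) (hd : ∑ S ∈ 𝒮 with S.card = d, τ S < 0) :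
    ∃ l : ℝ, 0 < l ∧ l ≤ 1 ∧ ∑ S ∈ 𝒮, l ^ S.card * τ S < 0 := by
  classical
  -- For `S.card < d` the truncated exponent is `0`; this is harmless because `τ S = 0` there.
  have hc : Continuous fun l : ℝ => ∑ S ∈ 𝒮, l ^ (S.card - d) * τ S := by fun_prop
  have hval : ∑ S ∈ 𝒮, (0 : ℝ) ^ (S.card - d) * τ S < 0 := by
    refine lt_of_eq_of_lt ?_ hd
    rw [Finset.sum_filter]
    refine Finset.sum_congr rfl fun S hS => ?_
    rcases lt_trichotomy S.card d with hlt | heq | hgt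
    · simp [h0 S hS hlt]
    · simp [heq]
    · simp [hgt.ne', Nat.sub_ne_zero_of_lt hgt]
  have hev := (hc.tendsto 0).eventually (gt_mem_nhds hval)
  rw [Metric.eventually_nhds_iff] at hev
  obtain ⟨ε, hε, hl⟩ := hev
  refine ⟨min (ε / 2) 1, by positivity, min_le_right _ _, ?_⟩
  set l := min (ε / 2) 1
  have hl0 : 0 < l := by positivity
  have := hl (y := l) (by
    rw [Real.dist_eq, sub_zero, abs_of_pos hl0]
    exact (min_le_left _ _).trans_lt (by linarith))
  have h2 : ∑ S ∈ 𝒮, l ^ S.card * τ S = l ^ d * ∑ S ∈ 𝒮, l ^ (S.card - d) * τ S := by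
    rw [Finset.mul_sum]
    refine Finset.sum_congr rfl fun S hS => ?_
    rcases lt_or_ge S.card d with hlt | hge
    · simp [h0 S hS hlt]
    · rw [← mul_assoc, ← pow_add, Nat.add_sub_cancel' hge]
  rw [h2]
  exact mul_neg_of_pos_of_neg (by positivity) this

/-- If the averages of `∏ i ∈ S, g n (φ i)` converge as `n → ∞`, then a negative total limit over
the sets `S` of the least relevant even size makes `L` uncommon. -/
theorem Represents.uncommon_of_tendsto (h : Represents L φ) (hφ : Function.Injective φ)
    {I : ℕ → Type*} [∀ n, Fintype (I n)] [∀ n, DecidableEq (I n)]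
    (g : ∀ n, (I n → F) → ℝ) (hg : ∀ n x, |g n x| ≤ 1) (τ : Finset ι → ℝ)
    (hlim : ∀ S, Filter.Tendsto (fun n => (∑ y : I n → W, ∏ i ∈ S, g n fun t => φ i (y t)) /
      (Fintype.card W : ℝ) ^ Fintype.card (I n)) Filter.atTop (nhds (τ S)))
    {d : ℕ} (hdeven : Even d) (hdpos : 0 < d)
    (h0 : ∀ S, Even S.card → S.Nonempty → S.card < d → τ S = 0)
    (hd : ∑ S : Finset ι with S.card = d, τ S < 0) : Uncommon L := by
  classical
  have hW : (0 : ℝ) < Fintype.card W := Nat.cast_pos.2 Fintype.card_pos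
  set 𝒮 : Finset (Finset ι) := {S | Even S.card ∧ S.Nonempty} with h𝒮
  obtain ⟨l, hl0, hl1, hl⟩ := exists_pow_mul_sum_neg 𝒮 τ d
    (fun S hS => by
      simp only [h𝒮, Finset.mem_filter, Finset.mem_univ, true_and] at hS
      exact h0 S hS.1 hS.2)
    (by
      convert hd using 2
      ext S
      simp only [h𝒮, Finset.mem_filter, Finset.mem_univ, true_and, and_iff_right_iff_imp]
      rintro rfl
      exact ⟨hdeven, Finset.card_pos.1 hdpos⟩)
  have ht : Filter.Tendsto (fun n => ∑ S ∈ 𝒮, l ^ S.card *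
      ((∑ y : I n → W, ∏ i ∈ S, g n fun t => φ i (y t)) /
        (Fintype.card W : ℝ) ^ Fintype.card (I n))) Filter.atTop
      (nhds (∑ S ∈ 𝒮, l ^ S.card * τ S)) :=
    tendsto_finsetSum _ fun S _ => (hlim S).const_mul _
  obtain ⟨n, hn⟩ := (ht.eventually (gt_mem_nhds hl)).exists
  refine h.uncommon hφ (fun x => l * g n x) (fun x => ?_) ?_
  · rw [abs_mul, abs_of_pos hl0]
    exact mul_le_one₀ hl1 (abs_nonneg _) (hg n x)
  · simp only [prod_one_add_add_prod_one_sub, Finset.prod_mul_distrib, Finset.prod_const]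
    rw [Finset.sum_add_distrib, ← Finset.mul_sum, Finset.sum_comm]
    simp only [← Finset.mul_sum]
    have hpos : (0 : ℝ) < (Fintype.card W : ℝ) ^ Fintype.card (I n) := by positivity
    simp only [← mul_div_assoc] at hn
    rw [← Finset.sum_div, div_lt_iff₀ hpos, zero_mul] at hn
    simp only [Finset.sum_const, Finset.card_univ, Fintype.card_fun, nsmul_eq_mul, Nat.cast_pow]
    linarith

end Criterion

/-! ### Systems with a zero form or two proportional forms. -/

section Dependent

variable {F : Type*} [Field F]

lemma exists_eq_smul_of_forall_apply_eq_zero {W : Type*} [AddCommGroup W] [Module F W]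
    {α β : W →ₗ[F] F} (h : ∀ w, α w = 0 → β w = 0) : ∃ r : F, β = r • α := by
  by_cases hα : α = 0
  · exact ⟨0, LinearMap.ext fun w => by simpa using h w (by simp [hα])⟩
  · obtain ⟨e, he⟩ : ∃ w, α w ≠ 0 := by
      by_contra! h
      exact hα (LinearMap.ext h)
    refine ⟨β e / α e, LinearMap.ext fun w => ?_⟩
    have := h (w - (α w / α e) • e) (by simp [he])
    simp only [map_sub, map_smul, smul_eq_mul, sub_eq_zero] at this
    simp only [LinearMap.smul_apply, smul_eq_mul, this]
    ring

variable {ι W : Type*} [Fintype ι] [AddCommGroup W] [Module F W] [Fintype W]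
  [Fintype F] [DecidableEq F]
  {m k : ℕ} {L : Matrix (Fin m) (Fin k) F} {φ : ι → W →ₗ[F] F}

/-- Only the zero vector gets the first colour. Since `φ i = 0`, the second colour contains no
solution, and the first only those with all variables zero. With `|ι|` coordinates, the proportion
`2 ^ (-|ι|)` of `y` killed by `φ j` offsets the product bound `2 ^ |ι|`, leaving an average of at
most `1`. -/
theorem Represents.uncommon_of_eq_zero (h : Represents L φ) (hφ : Function.Injective φ)
    (hι : 2 ≤ Fintype.card ι) {i : ι} (hi : φ i = 0) : Uncommon L := by
  classical
  obtain ⟨j, hj⟩ : ∃ j, j ≠ i := by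
    have : Nontrivial ι := Fintype.one_lt_card_iff_nontrivial.1 hι
    exact exists_ne i
  have hj0 : φ j ≠ 0 := fun h0 => hj (hφ (h0.trans hi.symm))
  have hW : (0 : ℝ) < Fintype.card W := Nat.cast_pos.2 Fintype.card_pos
  refine h.uncommon hφ (I := Fin (Fintype.card ι)) (fun x => if x = 0 then 1 else -1)
    (fun x => by split_ifs <;> simp) ?_
  have hy : ∀ y : Fin (Fintype.card ι) → W,
      ∏ i', (1 + if (fun t => φ i' (y t)) = 0 then (1 : ℝ) else -1) +
        ∏ i', (1 - if (fun t => φ i' (y t)) = 0 then (1 : ℝ) else -1) ≤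
      if ∀ t, φ j (y t) = 0 then 2 ^ Fintype.card ι else 0 := by
    intro y
    rw [Finset.prod_eq_zero (f := fun i' => 1 - if (fun t => φ i' (y t)) = 0 then (1 : ℝ) else -1)
      (Finset.mem_univ i) (by rw [if_pos (by ext; simp [hi])]; norm_num), add_zero]
    split_ifs with hall
    · refine (Finset.prod_le_prod (g := fun _ => 2) (fun _ _ => by split_ifs <;> norm_num)
        fun _ _ => by split_ifs <;> norm_num).trans_eq ?_
      rw [Finset.prod_const, Finset.card_univ]
    · refine (Finset.prod_eq_zero (Finset.mem_univ j) ?_).le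
      rw [if_neg fun h0 : (fun t => φ j (y t)) = 0 => hall (congrFun h0)]
      norm_num
  refine (Finset.sum_le_sum fun y _ => hy y).trans_lt ?_
  rw [← Finset.sum_filter, Finset.sum_const, nsmul_eq_mul, Fintype.card_fin]
  have hc := card_filter_forall_apply_eq_zero_le (I := Fin (Fintype.card ι)) hj0
  rw [Fintype.card_fin] at hc
  have hpow : (1 / 2 : ℝ) ^ Fintype.card ι * 2 ^ Fintype.card ι = 1 := by
    rw [← mul_pow]
    norm_num
  have hWpos : 0 < (Fintype.card W : ℝ) ^ Fintype.card ι := by positivity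
  calc _ ≤ (1 / 2 : ℝ) ^ Fintype.card ι * (Fintype.card W : ℝ) ^ Fintype.card ι *
        2 ^ Fintype.card ι := by
        gcongr
        exact (le_of_eq (by congr!)).trans hc
    _ = (Fintype.card W : ℝ) ^ Fintype.card ι := by
        rw [mul_right_comm, hpow, one_mul]
    _ < _ := by linarith

/-- The difference of the indicator functions of `1` and `c`. -/
def indicatorDiff (c x : F) : ℝ := (if x = 1 then 1 else 0) - if x = c then 1 else 0

omit [Fintype F] in
lemma abs_indicatorDiff_le (c x : F) : |indicatorDiff c x| ≤ 1 := by
  rw [indicatorDiff]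
  split_ifs <;> norm_num

omit [Fintype F] in
lemma indicatorDiff_mul_indicatorDiff_nonpos {c r : F} (hc : c ≠ 0) (hr : r ≠ 1) (x : F) :
    indicatorDiff c x * indicatorDiff c (r * x) ≤ 0 := by
  have key : ∀ y : F, y ≠ 0 → ¬ (x = y ∧ r * x = y) := by
    rintro y hy ⟨rfl, h2⟩
    exact hr (mul_right_cancel₀ hy (h2.trans (one_mul x).symm))
  have k1 := key 1 one_ne_zero
  have k2 := key c hc
  simp only [indicatorDiff]
  split_ifs <;> norm_num <;> tauto

/-- If `β` is a multiple of `α`, each summand is nonpositive. Otherwise translation along a vector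
in the kernel of `α` moves `β` freely, and the sum vanishes because `indicatorDiff c` has mean zero.
-/
lemma sum_indicatorDiff_mul_nonpos {c : F} (hc : c ≠ 0) {α β : W →ₗ[F] F} (hβ : β ≠ 0)
    (hαβ : α ≠ β) : ∑ w, indicatorDiff c (α w) * indicatorDiff c (β w) ≤ 0 := by
  by_cases h : ∀ w, α w = 0 → β w = 0
  · obtain ⟨r, rfl⟩ := exists_eq_smul_of_forall_apply_eq_zero h
    refine Finset.sum_nonpos fun w _ => indicatorDiff_mul_indicatorDiff_nonpos hc ?_ _
    rintro rfl
    exact hαβ (one_smul F α).symm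
  · push Not at h
    obtain ⟨e, he, he'⟩ := h
    have h1 : ∀ s : F, ∑ w, indicatorDiff c (α w) * indicatorDiff c (β w) =
        ∑ w, indicatorDiff c (α w) * indicatorDiff c (β w + s) := fun s => by
      refine (Fintype.sum_equiv (Equiv.addRight ((s / β e) • e)) _ _ fun w => ?_).symm
      simp [he, he']
    have h2 := Finset.sum_congr (rfl : (Finset.univ : Finset F) = _) fun s _ => h1 s
    have h3 : ∀ x : F, ∑ s, indicatorDiff c (x + s) = 0 := fun x => by
      rw [Fintype.sum_equiv (Equiv.addLeft x) (fun s => indicatorDiff c (x + s)) (indicatorDiff c)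
        fun s => rfl]
      simp [indicatorDiff, Finset.sum_sub_distrib]
    rw [Finset.sum_comm (s := Finset.univ (α := F)) (t := Finset.univ (α := W))
      (f := fun s w => indicatorDiff c (α w) * indicatorDiff c (β w + s)), Finset.sum_const,
      Finset.card_univ, nsmul_eq_mul] at h2
    simp only [← Finset.mul_sum, h3, mul_zero, Finset.sum_const_zero] at h2
    have hF : (Fintype.card F : ℝ) ≠ 0 := Nat.cast_ne_zero.2 Fintype.card_ne_zero
    exact ((mul_eq_zero.1 h2).resolve_left hF).le

/-- Pair correlations of `indicatorDiff c` are never positive, and the pair `i, j` is strictly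
negative: where `φ j` is `1` and `φ i` is `c`, the product is `-1`. -/
theorem Represents.uncommon_of_eq_smul (h : Represents L φ) (hφ : Function.Injective φ)
    (h0 : ∀ i, φ i ≠ 0) {i j : ι} (hij : i ≠ j) {c : F} (hc : φ i = c • φ j) : Uncommon L := by
  classical
  have hW : (0 : ℝ) < Fintype.card W := Nat.cast_pos.2 Fintype.card_pos
  have hc0 : c ≠ 0 := by
    rintro rfl
    exact h0 i (by simpa using hc)
  have hc1 : c ≠ 1 := by
    rintro rfl
    exact hij (hφ (by simpa using hc))
  have hsum : ∀ S : Finset ι,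
      ∑ y : Unit → W, ∏ i ∈ S, indicatorDiff c (φ i (y ())) =
        ∑ w, ∏ i ∈ S, indicatorDiff c (φ i w) := fun S =>
    Fintype.sum_equiv (Equiv.funUnique Unit W) _ _ fun y => rfl
  refine h.uncommon_of_tendsto hφ (I := fun _ => Unit) (fun _ x => indicatorDiff c (x ()))
    (fun _ x => abs_indicatorDiff_le _ _) _ (fun S => tendsto_const_nhds) (d := 2) even_two two_pos
    (fun S he hne hlt => ?_) (Finset.sum_neg' (fun S hS => ?_) ⟨{i, j}, ?_, ?_⟩)
  · have := hne.card_pos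
    have : S.card = 1 := by omega
    rw [this] at he
    exact absurd he (by decide)
  · obtain ⟨a, b, hab, rfl⟩ := Finset.card_eq_two.1 (Finset.mem_filter.1 hS).2
    rw [hsum]
    refine div_nonpos_of_nonpos_of_nonneg ?_ (by positivity)
    simp only [Finset.prod_pair hab]
    exact sum_indicatorDiff_mul_nonpos hc0 (h0 b) (hφ.ne hab)
  · simp [Finset.card_pair hij]
  · rw [hsum]
    refine div_neg_of_neg_of_pos ?_ (by positivity)
    simp only [Finset.prod_pair hij, hc]
    obtain ⟨e, he⟩ : ∃ w, φ j w ≠ 0 := by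
      by_contra! h
      exact h0 j (LinearMap.ext h)
    refine Finset.sum_neg' (fun w _ => ?_) ⟨(φ j e)⁻¹ • e, Finset.mem_univ _, ?_⟩
    · rw [mul_comm]
      exact indicatorDiff_mul_indicatorDiff_nonpos hc0 hc1 _
    · have hval : φ j ((φ j e)⁻¹ • e) = 1 := by simp [he]
      simp only [LinearMap.smul_apply, hval]
      simp [indicatorDiff, hc1, hc1.symm]

end Dependent

/-! ### Averages of quadratic phases. -/

section QuadraticPhase

lemma norm_sum_lt_card {W : Type*} [Fintype W] {f : W → ℂ} (hf : ∀ w, ‖f w‖ = 1) {a b : W}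
    (hab : f a ≠ f b) : ‖∑ w, f w‖ < Fintype.card W := by
  classical
  have hne : b ≠ a := fun h => hab (h ▸ rfl)
  have h2 : ‖f a + f b‖ < 2 := by
    have := norm_add_lt_of_not_sameRay ((not_sameRay_iff_of_norm_eq ((hf a).trans (hf b).symm)).2 hab)
    rw [hf, hf] at this
    linarith
  have hb : b ∈ Finset.univ.erase a := Finset.mem_erase.2 ⟨hne, Finset.mem_univ b⟩
  rw [← Finset.add_sum_erase _ _ (Finset.mem_univ a), ← Finset.add_sum_erase _ _ hb, ← add_assoc]
  have h3 : ‖∑ w ∈ (Finset.univ.erase a).erase b, f w‖ ≤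
      ((Finset.univ.erase a).erase b).card := by
    refine (norm_sum_le _ _).trans ?_
    simp [hf]
  have h4 : ((Finset.univ.erase a).erase b).card + 2 = Fintype.card W := by
    have e1 := Finset.card_erase_add_one hb
    have e2 := Finset.card_erase_add_one (Finset.mem_univ a)
    rw [Finset.card_univ] at e2
    omega
  have h5 : (Fintype.card W : ℝ) = ((Finset.univ.erase a).erase b).card + 2 := by
    rw [← h4]
    push_cast
    rfl
  linarith [norm_add_le (f a + f b) (∑ w ∈ (Finset.univ.erase a).erase b, f w)]

variable {F : Type*} [Field F] [Finite F]

omit [Finite F] in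
lemma addChar_map_sum {κ : Type*} (ψ : AddChar F ℂ) (s : Finset κ) (f : κ → F) :
    ψ (∑ i ∈ s, f i) = ∏ i ∈ s, ψ (f i) := by
  classical
  induction s using Finset.induction_on with
  | empty => simp
  | insert a s ha ih => rw [Finset.sum_insert ha, Finset.prod_insert ha, ψ.map_add_eq_mul, ih]

omit [Finite F] in
lemma eq_zero_of_forall_addChar_sq_mul_eq_one (h2 : (2 : F) ≠ 0) {ψ : AddChar F ℂ} (hψ : ψ ≠ 1)
    {a : F} (h : ∀ t : F, ψ (t ^ 2 * a) = 1) : a = 0 := by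
  by_contra ha
  refine hψ (AddChar.eq_one_iff.2 fun b => ?_)
  -- In odd characteristic every element is a difference of two squares.
  have hb : b = ((b / a + 1) / 2) ^ 2 * a - ((b / a - 1) / 2) ^ 2 * a := by
    field_simp
    ring
  rw [hb, AddChar.map_sub_eq_div, h, h, div_one]

variable {J W : Type*} [Fintype J] [AddCommGroup W] [Module F W] [Fintype W]

/-- A nonzero quadratic form takes, along some line, a value at which `ψ` differs from `1`. The
strict triangle inequality then makes the average of norm less than `1`. -/
lemma tendsto_average_addChar_pow (h2 : (2 : F) ≠ 0) {ψ : AddChar F ℂ} (hψ : ψ ≠ 1)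
    (φ : J → W →ₗ[F] F) (η : J → F) [Decidable (∀ w, ∑ i, η i * φ i w ^ 2 = 0)] :
    Filter.Tendsto
      (fun n : ℕ => ((∑ w, ψ (∑ i, η i * φ i w ^ 2)) / (Fintype.card W : ℂ)) ^ n) Filter.atTop
      (nhds (if ∀ w, ∑ i, η i * φ i w ^ 2 = 0 then 1 else 0)) := by
  have hW : (Fintype.card W : ℂ) ≠ 0 := Nat.cast_ne_zero.2 Fintype.card_ne_zero
  split_ifs with h
  · simp [h, hW]
  · push Not at h
    obtain ⟨w, hw⟩ := h
    obtain ⟨t, ht⟩ : ∃ t : F, ψ (t ^ 2 * ∑ i, η i * φ i w ^ 2) ≠ 1 := by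
      by_contra! hall
      exact hw (eq_zero_of_forall_addChar_sq_mul_eq_one h2 hψ hall)
    refine tendsto_pow_atTop_nhds_zero_of_norm_lt_one ?_
    rw [norm_div, Complex.norm_natCast, div_lt_one (Nat.cast_pos.2 Fintype.card_pos)]
    refine norm_sum_lt_card (fun w => ψ.norm_apply _) (a := t • w) (b := 0) ?_
    convert ht using 1
    · rw [Finset.mul_sum]
      simp only [map_smul, smul_eq_mul]
      congr 1
      exact Finset.sum_congr rfl fun i _ => by ring
    · simp

end QuadraticPhase

/-! ### The chirp function and its limiting correlations. -/

section ArithmeticProgression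

variable {F : Type*} [Field F] [Fintype F] [DecidableEq F]

/-- The second coordinate of the point of the line `{1} × F` on which a term of `chirp` lives. -/
def chirpPoint (F : Type*) [Field F] (κ : Fin 4 × Bool) : F := ((κ.1 : ℕ) : F)

/-- The frequency of the quadratic phase of a term of `chirp`. -/
def chirpFreq (F : Type*) [Field F] (κ : Fin 4 × Bool) : F :=
  (if κ.2 then 1 else -1) * ![1, 3, 3, 1] κ.1

/-- The coefficient of a term of `chirp`. -/
noncomputable def chirpCoeff (j : Fin 4) : ℝ := ![1, 1, -1, 1] j / 8

/-- A signed combination of four real quadratic phases, carried by the four points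
`(1, 0), …, (1, 3)` of `F²`; it is Fourier-uniform but correlates negatively along 4-term
progressions. -/
noncomputable def chirp (ψ : AddChar F ℂ) (n : ℕ) (x : Bool ⊕ Fin n → F) : ℂ :=
  ∑ κ : Fin 4 × Bool, (chirpCoeff κ.1 : ℂ) *
    (if x (Sum.inl false) = 1 ∧ x (Sum.inl true) = chirpPoint F κ then 1 else 0) *
    ψ (chirpFreq F κ * ∑ t, x (Sum.inr t) ^ 2)

/-- Conjugation swaps the two terms of opposite frequency at each point. -/
lemma chirp_ofReal_re (ψ : AddChar F ℂ) (n : ℕ) (x : Bool ⊕ Fin n → F) :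
    ((chirp ψ n x).re : ℂ) = chirp ψ n x := by
  rw [← Complex.conj_eq_iff_re, chirp, map_sum]
  refine Fintype.sum_equiv ((Equiv.refl _).prodCongr Equiv.boolNot) _ _ fun κ => ?_
  rcases κ with ⟨j, b⟩
  simp only [map_mul, Complex.conj_ofReal, ← AddChar.map_neg_eq_conj]
  congr 1
  · congr 1
    rw [apply_ite (starRingEnd ℂ), map_one, map_zero]
    rfl
  · congr 1
    cases b <;> simp [chirpFreq]

lemma abs_chirp_re_le (ψ : AddChar F ℂ) (n : ℕ) (x : Bool ⊕ Fin n → F) :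
    |(chirp ψ n x).re| ≤ 1 := by
  refine (Complex.abs_re_le_norm _).trans ((norm_sum_le _ _).trans ?_)
  refine (Finset.sum_le_sum (g := fun _ => (1 / 8 : ℝ)) fun κ _ => ?_).trans (by norm_num)
  rw [norm_mul, norm_mul, ψ.norm_apply, mul_one, Complex.norm_real]
  have h1 : ‖chirpCoeff κ.1‖ = 1 / 8 := by
    rw [chirpCoeff, Real.norm_eq_abs]
    fin_cases κ <;> norm_num
  rw [h1]
  split_ifs <;> norm_num

lemma sum_mul_sum_sumType {α β W R : Type*} [Fintype α] [Fintype β] [DecidableEq α] [DecidableEq β]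
    [Fintype W] [CommSemiring R] (f : (α → W) → R) (g : (β → W) → R) :
    ∑ y : α ⊕ β → W, f (fun a => y (Sum.inl a)) * g (fun b => y (Sum.inr b)) =
      (∑ u, f u) * ∑ z, g z := by
  have h := Fintype.sum_equiv (Equiv.sumArrowEquivProdArrow α β W)
    (fun y => f (fun a => y (Sum.inl a)) * g (fun b => y (Sum.inr b)))
    (fun uz => f uz.1 * g uz.2) fun y => rfl
  rw [h, Fintype.sum_prod_type, Finset.sum_mul_sum]

variable {J W : Type*} [Fintype J] [DecidableEq J] [AddCommGroup W] [Module F W] [Fintype W]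

/-- The number of pairs in `W²` whose images under the forms `φ` are the points given by `κ`. -/
def chirpCount (φ : J → W →ₗ[F] F) (κ : J → Fin 4 × Bool) : ℕ :=
  ({u | ∀ i, φ i (u false) = 1 ∧ φ i (u true) = chirpPoint F (κ i)} : Finset (Bool → W)).card

-- Once the product is expanded, each term separates over coordinates: the two labelled by `Bool`
-- count point configurations, and each of the other `n` contributes the same exponential sum.
omit [Fintype F] in
lemma sum_prod_chirp (ψ : AddChar F ℂ) (φ : J → W →ₗ[F] F) (n : ℕ) :
    ∑ y : Bool ⊕ Fin n → W, ∏ i, chirp ψ n (fun t => φ i (y t)) =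
      ∑ κ : J → Fin 4 × Bool, ((∏ i, chirpCoeff (κ i).1 : ℝ) : ℂ) * chirpCount φ κ *
        (∑ w, ψ (∑ i, chirpFreq F (κ i) * φ i w ^ 2)) ^ n := by
  simp only [chirp, Finset.prod_univ_sum, Fintype.piFinset_univ]
  rw [Finset.sum_comm]
  refine Finset.sum_congr rfl fun κ _ => ?_
  have hψ : ∀ z : Fin n → W, ∏ i, ψ (chirpFreq F (κ i) * ∑ t, φ i (z t) ^ 2) =
      ∏ t, ψ (∑ i, chirpFreq F (κ i) * φ i (z t) ^ 2) := by
    intro z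
    simp only [Finset.mul_sum, addChar_map_sum]
    exact Finset.prod_comm
  have hcount : (chirpCount φ κ : ℂ) = ∑ u : Bool → W,
      ∏ i, if φ i (u false) = 1 ∧ φ i (u true) = chirpPoint F (κ i) then 1 else 0 := by
    simp [chirpCount, Finset.prod_boole]
  rw [Fintype.sum_pow, mul_assoc, hcount, ← sum_mul_sum_sumType, Finset.mul_sum]
  refine Finset.sum_congr rfl fun y _ => ?_
  rw [Finset.prod_mul_distrib, Finset.prod_mul_distrib, hψ fun t => y (Sum.inr t),
    Complex.ofReal_prod, mul_assoc]

/-- The contribution of `κ` to the limiting average of the product of the functions `chirp`. -/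
noncomputable def chirpTerm (φ : J → W →ₗ[F] F) (κ : J → Fin 4 × Bool) : ℝ :=
  (∏ i, chirpCoeff (κ i).1) * (chirpCount φ κ / (Fintype.card W : ℝ) ^ 2) *
    if ∀ w, ∑ i, chirpFreq F (κ i) * φ i w ^ 2 = 0 then 1 else 0

lemma tendsto_average_prod_chirp (h2 : (2 : F) ≠ 0) {ψ : AddChar F ℂ} (hψ : ψ ≠ 1)
    (φ : J → W →ₗ[F] F) :
    Filter.Tendsto (fun n => (∑ y : Bool ⊕ Fin n → W, ∏ i, (chirp ψ n fun t => φ i (y t)).re) /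
      (Fintype.card W : ℝ) ^ Fintype.card (Bool ⊕ Fin n)) Filter.atTop
      (nhds (∑ κ : J → Fin 4 × Bool, chirpTerm φ κ)) := by
  have hW : (Fintype.card W : ℂ) ≠ 0 := Nat.cast_ne_zero.2 Fintype.card_ne_zero
  have h : ∀ n : ℕ, (∑ y : Bool ⊕ Fin n → W, ∏ i, (chirp ψ n fun t => φ i (y t)).re) /
      (Fintype.card W : ℝ) ^ Fintype.card (Bool ⊕ Fin n) =
      (∑ κ : J → Fin 4 × Bool, ((∏ i, chirpCoeff (κ i).1 : ℝ) : ℂ) *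
        (chirpCount φ κ / (Fintype.card W : ℂ) ^ 2) *
        ((∑ w, ψ (∑ i, chirpFreq F (κ i) * φ i w ^ 2)) / (Fintype.card W : ℂ)) ^ n).re := by
    intro n
    rw [← Complex.ofReal_re (_ / _)]
    congr 1
    push_cast
    simp only [chirp_ofReal_re, sum_prod_chirp, Fintype.card_sum, Fintype.card_bool,
      Fintype.card_fin, pow_add]
    rw [Finset.sum_div]
    refine Finset.sum_congr rfl fun κ _ => ?_
    rw [div_pow]
    push_cast
    field_simp
  simp only [h]
  have hre : ∑ κ : J → Fin 4 × Bool, chirpTerm φ κ =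
      (∑ κ : J → Fin 4 × Bool, ((∏ i, chirpCoeff (κ i).1 : ℝ) : ℂ) *
        (chirpCount φ κ / (Fintype.card W : ℂ) ^ 2) *
        (if ∀ w, ∑ i, chirpFreq F (κ i) * φ i w ^ 2 = 0 then 1 else 0)).re := by
    rw [← Complex.ofReal_re (∑ κ, _)]
    congr 1
    simp only [chirpTerm]
    push_cast
    refine Finset.sum_congr rfl fun κ _ => ?_
    congr 1
    split_ifs <;> simp
  rw [hre]
  exact (Complex.continuous_re.tendsto _).comp <| tendsto_finsetSum _ fun κ _ =>
    (tendsto_average_addChar_pow h2 hψ φ _).const_mul _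

end ArithmeticProgression

/-! ### Linear relations among the squares of four forms. -/

section Algebra

variable {F : Type*} [Field F]

/-- Any two of the forms `φ` are linearly independent. -/
def PairwiseIndep {J W : Type*} [AddCommGroup W] [Module F W] (φ : J → W →ₗ[F] F) : Prop :=
  ∀ i j, i ≠ j → ∃ w, φ i w = 1 ∧ φ j w = 0

lemma chirpFreq_ne_zero (h3 : (3 : F) ≠ 0) (κ : Fin 4 × Bool) : chirpFreq F κ ≠ 0 := by
  rcases κ with ⟨j, b⟩
  fin_cases j <;> cases b <;> simp [chirpFreq, h3]

lemma chirpPoint_eq_iff (h2 : (2 : F) ≠ 0) (h3 : (3 : F) ≠ 0) {κ κ' : Fin 4 × Bool} :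
    chirpPoint F κ = chirpPoint F κ' ↔ κ.1 = κ'.1 := by
  have h21 : (2 : F) ≠ 1 := fun h => one_ne_zero (by linear_combination h : (1 : F) = 0)
  have h31 : (3 : F) ≠ 1 := fun h => h2 (by linear_combination h)
  have h32 : (3 : F) ≠ 2 := fun h => one_ne_zero (by linear_combination h : (1 : F) = 0)
  refine ⟨fun h => ?_, fun h => by rw [chirpPoint, chirpPoint, h]⟩
  rcases κ with ⟨j, b⟩
  rcases κ' with ⟨j', b'⟩
  simp only [chirpPoint] at h
  fin_cases j <;> fin_cases j' <;> simp_all [h2.symm, h3.symm, h21.symm, h31.symm, h32.symm]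

lemma chirpFreq_eq_of_fst_eq {κ : Fin 4 × Bool} {j : Fin 4} (h : κ.1 = j) :
    chirpFreq F κ = chirpFreq F (j, true) ∨ chirpFreq F κ = -chirpFreq F (j, true) := by
  subst h
  rcases κ with ⟨j, b⟩
  cases b <;> simp [chirpFreq]

variable {W : Type*} [AddCommGroup W] [Module F W]

lemma sum_mul_mul_eq_zero_of_sum_mul_sq_eq_zero {J : Type*} [Fintype J] (h2 : (2 : F) ≠ 0)
    {φ : J → W →ₗ[F] F} {η : J → F} (h : ∀ w, ∑ i, η i * φ i w ^ 2 = 0) (v w : W) :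
    ∑ i, η i * φ i v * φ i w = 0 := by
  have e : ∑ i, η i * φ i (v + w) ^ 2 =
      ∑ i, η i * φ i v ^ 2 + ∑ i, η i * φ i w ^ 2 + 2 * ∑ i, η i * φ i v * φ i w := by
    rw [Finset.mul_sum, ← Finset.sum_add_distrib, ← Finset.sum_add_distrib]
    refine Finset.sum_congr rfl fun i _ => ?_
    rw [map_add]
    ring
  rw [h, h, h] at e
  simpa [h2] using e.symm

/-- If `1` lies in the image of four pairwise independent forms, whose squares are dependent, then
each vector of the image has equal or pairwise distinct entries. -/
lemma apply_eq_of_apply_eq_of_apply_eq (h2 : (2 : F) ≠ 0) {φ : Fin 4 → W →ₗ[F] F}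
    (hφ : PairwiseIndep φ) {η : Fin 4 → F} (hη : ∀ i, η i ≠ 0)
    (h : ∀ w, ∑ i, η i * φ i w ^ 2 = 0) {u : W} (hu : ∀ i, φ i u = 1) {a b : Fin 4} (hab : a ≠ b)
    {w : W} {t : F} (ha : φ a w = t) (hb : φ b w = t) (i : Fin 4) : φ i w = t := by
  by_cases hia : i = a
  · rw [hia, ha]
  by_cases hib : i = b
  · rw [hib, hb]
  have hfourth : ∀ a b i : Fin 4, a ≠ b → i ≠ a → i ≠ b →
      ∃ c, c ≠ i ∧ ∀ j, j ≠ i → j = a ∨ j = b ∨ j = c := by decide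
  obtain ⟨c, hci, hc⟩ := hfourth a b i hab hia hib
  -- Pair `w - t u` with `v` under the polarised relation. The terms at `a` and `b` vanish because
  -- `w - t u` does there, the term at `c` because `v` does; only `η i * (φ i w - t)` remains.
  obtain ⟨v, hv1, hv0⟩ := hφ i c hci.symm
  have e1 := sum_mul_mul_eq_zero_of_sum_mul_sq_eq_zero h2 h w v
  have e2 := sum_mul_mul_eq_zero_of_sum_mul_sq_eq_zero h2 h u v
  have e3 : ∑ j, η j * (φ j w - t) * φ j v = 0 := by
    have : ∑ j, η j * (φ j w - t) * φ j v =
        ∑ j, η j * φ j w * φ j v - t * ∑ j, η j * φ j u * φ j v := by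
      rw [Finset.mul_sum, ← Finset.sum_sub_distrib]
      refine Finset.sum_congr rfl fun j _ => ?_
      rw [hu]
      ring
    rw [this, e1, e2]
    ring
  rw [Finset.sum_eq_single i (fun j _ hj => by
    rcases hc j hj with rfl | rfl | rfl
    · rw [ha]; ring
    · rw [hb]; ring
    · rw [hv0]; ring) (fun hi => absurd (Finset.mem_univ i) hi), hv1, mul_one] at e3
  exact sub_eq_zero.1 ((mul_eq_zero.1 e3).resolve_left (hη i))

/-- Two signs are positive and two negative. If `s 1 = s 0`, then `z + t = z² + t² = 1`, so `2zt =
0`. If `s 1 = -s 0`, then `z - t = z² - t² = ±1`, so `z + t = 1` and one of `z`, `t` is zero. -/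
lemma false_of_sign_sums_eq_zero (h2 : (2 : F) ≠ 0) {s : Fin 4 → F} (hs : ∀ i, s i = 1 ∨ s i = -1)
    {z t : F} (hz : z ≠ 0) (ht : t ≠ 0) (e0 : s 0 + s 1 + s 2 + s 3 = 0)
    (e1 : s 0 + s 2 * z + s 3 * t = 0) (e2 : s 0 + s 2 * z ^ 2 + s 3 * t ^ 2 = 0) : False := by
  have h4 : (4 : F) ≠ 0 := by
    have := mul_ne_zero h2 h2
    norm_num at this
    exact this
  rcases hs 0 with a | a <;> rcases hs 1 with b | b <;> rcases hs 2 with c | c <;>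
    rcases hs 3 with d | d <;> rw [a, c, d] at e1 e2 <;> rw [a, b, c, d] at e0
  all_goals grind

/-- A repeated point forces all four points to coincide, by the rigidity in
`apply_eq_of_apply_eq_of_apply_eq`. The frequencies then agree up to sign, and a relation among the
squares with coefficients `±1` is excluded by `false_of_sign_sums_eq_zero`. -/
lemma injective_fst_of_sum_chirpFreq_mul_sq_eq_zero (h2 : (2 : F) ≠ 0) (h3 : (3 : F) ≠ 0)
    {φ : Fin 4 → W →ₗ[F] F} (hφ : PairwiseIndep φ) {κ : Fin 4 → Fin 4 × Bool}
    (h : ∀ w, ∑ i, chirpFreq F (κ i) * φ i w ^ 2 = 0) {u u' : W} (hu : ∀ i, φ i u = 1)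
    (hu' : ∀ i, φ i u' = chirpPoint F (κ i)) : Function.Injective fun i => (κ i).1 := by
  have key := fun {a b : Fin 4} (hab : a ≠ b) {w : W} {t : F} (ha : φ a w = t) (hb : φ b w = t) =>
    apply_eq_of_apply_eq_of_apply_eq h2 hφ (fun i => chirpFreq_ne_zero h3 (κ i)) h hu hab ha hb
  intro a b hab
  by_contra hne
  have hconst : ∀ i, (κ i).1 = (κ a).1 := fun i => by
    rw [← chirpPoint_eq_iff h2 h3, ← hu']
    refine key hne (hu' a) ((hu' b).trans ?_) i
    exact (chirpPoint_eq_iff h2 h3).2 hab.symm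
  set c := chirpFreq F ((κ a).1, true) with hc
  have hc0 : c ≠ 0 := chirpFreq_ne_zero h3 _
  choose s hs hsc using fun i => show ∃ s : F, (s = 1 ∨ s = -1) ∧ chirpFreq F (κ i) = c * s from by
    rcases chirpFreq_eq_of_fst_eq (F := F) (hconst i) with h | h
    · exact ⟨1, Or.inl rfl, by rw [h, mul_one]⟩
    · exact ⟨-1, Or.inr rfl, by rw [h, mul_neg, mul_one]⟩
  have hpol : ∀ v w, ∑ i, s i * φ i v * φ i w = 0 := fun v w => by
    have := sum_mul_mul_eq_zero_of_sum_mul_sq_eq_zero h2 h v w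
    simp only [hsc, mul_assoc, ← Finset.mul_sum] at this
    simpa only [mul_assoc] using (mul_eq_zero.1 this).resolve_left hc0
  -- By the same rigidity `φ 2 v` and `φ 3 v` are nonzero: a second zero entry would make `φ 0 v`
  -- zero too.
  obtain ⟨v, hv0, hv1⟩ := hφ 0 1 (by decide)
  have e0 := hpol u u
  have e1 := hpol u v
  have e2 := hpol v v
  simp only [hu, mul_one, Fin.sum_univ_four, hv0, hv1, mul_zero, add_zero] at e0 e1 e2
  refine false_of_sign_sums_eq_zero h2 hs (z := φ 2 v) (t := φ 3 v) (fun hz => ?_) (fun ht => ?_)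
    e0 e1 (by linear_combination e2)
  · exact one_ne_zero (hv0.symm.trans (key (by decide : (1 : Fin 4) ≠ 2) hv1 hz 0))
  · exact one_ne_zero (hv0.symm.trans (key (by decide : (1 : Fin 4) ≠ 3) hv1 ht 0))

lemma prod_chirpCoeff_of_injective {J : Type*} [Fintype J] (hJ : Fintype.card J = 4)
    {κ : J → Fin 4} (hκ : Function.Injective κ) : ∏ i, chirpCoeff (κ i) < 0 := by
  have hb : Function.Bijective κ :=
    (Fintype.bijective_iff_injective_and_card κ).2 ⟨hκ, by rw [hJ, Fintype.card_fin]⟩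
  rw [hb.prod_comp chirpCoeff, Fin.prod_univ_four]
  simp [chirpCoeff]
  norm_num

end Algebra

/-! ### Negative correlation from a 4-term progression. -/

section FourTerm

variable {F : Type*} [Field F] [DecidableEq F]
  {J W : Type*} [Fintype J] [AddCommGroup W] [Module F W] [Fintype W]
  {φ : J → W →ₗ[F] F}

/-- At a vector where one form is `1` and the other `0`, the phase equals a nonzero frequency. -/
lemma chirpTerm_eq_zero_of_card_eq_two (h3 : (3 : F) ≠ 0) (hφ : PairwiseIndep φ)
    (hJ : Fintype.card J = 2) (κ : J → Fin 4 × Bool) : chirpTerm φ κ = 0 := by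
  classical
  rw [chirpTerm, if_neg, mul_zero]
  intro h
  obtain ⟨a, b, hab, hu⟩ := Finset.card_eq_two.1 (Finset.card_univ.trans hJ)
  obtain ⟨w, hw1, hw0⟩ := hφ a b hab
  have := h w
  rw [hu, Finset.sum_pair hab, hw1, hw0] at this
  exact chirpFreq_ne_zero h3 (κ a) (by linear_combination this)

lemma chirpTerm_nonpos_of_card_eq_four (h2 : (2 : F) ≠ 0) (h3 : (3 : F) ≠ 0)
    (hφ : PairwiseIndep φ) (hJ : Fintype.card J = 4) (κ : J → Fin 4 × Bool) :
    chirpTerm φ κ ≤ 0 := by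
  rw [chirpTerm]
  split_ifs with h
  · rcases Finset.eq_empty_or_nonempty ({u | ∀ i, φ i (u false) = 1 ∧
      φ i (u true) = chirpPoint F (κ i)} : Finset (Bool → W)) with he | ⟨u, hu⟩
    · simp [chirpCount, he]
    · have hu : ∀ i, φ i (u false) = 1 ∧ φ i (u true) = chirpPoint F (κ i) := by simpa using hu
      let E : Fin 4 ≃ J := (Fintype.equivFinOfCardEq hJ).symm
      have hinj := injective_fst_of_sum_chirpFreq_mul_sq_eq_zero h2 h3 (φ := fun i => φ (E i))
        (κ := fun i => κ (E i)) (fun i j hij => hφ _ _ (E.injective.ne hij))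
        (fun w => (E.sum_comp fun i => chirpFreq F (κ i) * φ i w ^ 2).trans (h w))
        (fun i => (hu (E i)).1) (fun i => (hu (E i)).2)
      have hneg := prod_chirpCoeff_of_injective (Fintype.card_fin 4) hinj
      rw [E.prod_comp fun i => chirpCoeff (κ i).1] at hneg
      rw [mul_one]
      exact mul_nonpos_of_nonpos_of_nonneg hneg.le (by positivity)
  · simp

lemma exists_chirpTerm_neg (hφ : PairwiseIndep φ) (E : Fin 4 ≃ J)
    (h₁ : ∀ w, φ (E 0) w - 2 * φ (E 1) w + φ (E 2) w = 0)
    (h₂ : ∀ w, φ (E 1) w - 2 * φ (E 2) w + φ (E 3) w = 0) :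
    ∃ κ : J → Fin 4 × Bool, chirpTerm φ κ < 0 := by
  have hW : (0 : ℝ) < Fintype.card W := Nat.cast_pos.2 Fintype.card_pos
  have e2 : ∀ w, φ (E 2) w = 2 * φ (E 1) w - φ (E 0) w := fun w => by
    linear_combination h₁ w
  have e3 : ∀ w, φ (E 3) w = 3 * φ (E 1) w - 2 * φ (E 0) w := fun w => by
    linear_combination h₂ w + 2 * h₁ w
  -- The alternating signs turn the frequencies into `1, -3, 3, -1`, the coefficients of the third
  -- difference, which annihilates squares along a progression.
  let κ : J → Fin 4 × Bool := fun i => (E.symm i, ![true, false, true, false] (E.symm i))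
  have hκ : ∀ j, κ (E j) = (j, ![true, false, true, false] j) := fun j => by simp [κ]
  have hq : ∀ w, ∑ i, chirpFreq F (κ i) * φ i w ^ 2 = 0 := fun w => by
    rw [← E.sum_comp fun i => chirpFreq F (κ i) * φ i w ^ 2]
    simp only [hκ, Fin.sum_univ_four, e2, e3]
    simp [chirpFreq]
    ring
  have hprod : ∏ i, chirpCoeff (κ i).1 < 0 :=
    prod_chirpCoeff_of_injective (Fintype.card_congr E.symm |>.trans (Fintype.card_fin 4))
      E.symm.injective
  obtain ⟨v, hv0, hv1⟩ := hφ (E 0) (E 1) (E.injective.ne (by decide))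
  obtain ⟨w, hw1, hw0⟩ := hφ (E 1) (E 0) (E.injective.ne (by decide))
  have hcount : 0 < chirpCount φ κ := by
    -- Along the progression `v + w` takes the values `1, 1, 1, 1` and `w` the values `0, 1, 2, 3`.
    refine Finset.card_pos.2 ⟨fun b => if b then w else v + w, ?_⟩
    simp only [Finset.mem_filter, Finset.mem_univ, true_and]
    rw [← E.forall_congr_right]
    simp only [hκ, chirpPoint, if_true, Bool.false_eq_true, if_false]
    intro j
    fin_cases j <;> simp [e2, e3, hv0, hv1, hw0, hw1] <;> norm_num
  refine ⟨κ, ?_⟩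
  rw [chirpTerm, if_pos hq, mul_one]
  exact mul_neg_of_neg_of_pos hprod (by positivity)

variable [Fintype F] {ι : Type*} [Fintype ι] {m k : ℕ} {L : Matrix (Fin m) (Fin k) F}

theorem Represents.uncommon_of_pairwiseIndep {φ : ι → W →ₗ[F] F} (h : Represents L φ)
    (hφ : PairwiseIndep φ) (h2 : (2 : F) ≠ 0) (h3 : (3 : F) ≠ 0) (e : Fin 4 ↪ ι)
    (h₁ : ∀ w, φ (e 0) w - 2 * φ (e 1) w + φ (e 2) w = 0)
    (h₂ : ∀ w, φ (e 1) w - 2 * φ (e 2) w + φ (e 3) w = 0) : Uncommon L := by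
  classical
  obtain ⟨ψ, hψ⟩ : ∃ ψ : AddChar F ℂ, ψ ≠ 1 := by
    obtain ⟨ψ, hψ⟩ := AddChar.exists_apply_ne_zero.2 (one_ne_zero (α := F))
    exact ⟨ψ, AddChar.ne_one_iff.2 ⟨1, hψ⟩⟩
  have hinj : Function.Injective φ := fun i j hij => by
    by_contra hne
    obtain ⟨w, hw1, hw0⟩ := hφ i j hne
    rw [hij, hw0] at hw1
    exact zero_ne_one hw1
  have hsub : ∀ S : Finset ι, PairwiseIndep fun i : S => φ i := fun S i j hij =>
    hφ i j (Subtype.coe_injective.ne hij)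
  have hcard : ∀ (S : Finset ι) (d : ℕ), S.card = d → Fintype.card S = d := fun S d hS => by
    rw [Fintype.card_coe, hS]
  refine h.uncommon_of_tendsto hinj (fun n x => (chirp ψ n x).re) (fun n x => abs_chirp_re_le ψ n x)
    (fun S => ∑ κ : S → Fin 4 × Bool, chirpTerm (fun i : S => φ i) κ) (fun S => ?_) (d := 4)
    (by decide) (by decide) (fun S heven hne hlt => ?_)
    (Finset.sum_neg' (fun S hS => ?_) ⟨Finset.univ.map e, ?_, ?_⟩)
  · have := tendsto_average_prod_chirp h2 hψ fun i : S => φ i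
    refine this.congr fun n => ?_
    congr 1
    exact Finset.sum_congr rfl fun y _ =>
      Finset.prod_coe_sort S fun i => (chirp ψ n fun t => φ i (y t)).re
  · have hpos := hne.card_pos
    obtain ⟨r, hr⟩ := heven
    exact Finset.sum_eq_zero fun κ _ =>
      chirpTerm_eq_zero_of_card_eq_two h3 (hsub S) (hcard S 2 (by omega)) κ
  · exact Finset.sum_nonpos fun κ _ => chirpTerm_nonpos_of_card_eq_four h2 h3 (hsub S)
      (hcard S 4 (Finset.mem_filter.1 hS).2) κ
  · simp
  · set S := Finset.univ.map e with hS
    let E : Fin 4 ≃ S := Equiv.ofBijective (fun j => ⟨e j, by simp [hS]⟩)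
      ⟨fun i j hij => e.injective (congrArg Subtype.val hij), fun ⟨i, hi⟩ => by
        obtain ⟨j, -, rfl⟩ := Finset.mem_map.1 hi
        exact ⟨j, rfl⟩⟩
    obtain ⟨κ, hκ⟩ := exists_chirpTerm_neg (hsub S) E h₁ h₂
    exact Finset.sum_neg' (fun κ _ => chirpTerm_nonpos_of_card_eq_four h2 h3 (hsub S)
      (hcard S 4 (by simp [hS])) κ) ⟨κ, Finset.mem_univ _, hκ⟩

/-- A system whose forms are distinct and contain a 4-term progression is uncommon. -/
theorem Represents.uncommon_of_fourTerm {φ : ι → W →ₗ[F] F} (h : Represents L φ)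
    (hφ : Function.Injective φ) (h2 : (2 : F) ≠ 0) (e : Fin 4 ↪ ι)
    (h₁ : ∀ w, φ (e 0) w - 2 * φ (e 1) w + φ (e 2) w = 0)
    (h₂ : ∀ w, φ (e 1) w - 2 * φ (e 2) w + φ (e 3) w = 0) : Uncommon L := by
  by_cases h0 : ∃ i, φ i = 0
  · obtain ⟨i, hi⟩ := h0
    refine h.uncommon_of_eq_zero hφ ?_ hi
    have := Fintype.card_le_of_embedding e
    rw [Fintype.card_fin] at this
    omega
  push Not at h0
  by_cases hind : PairwiseIndep φ
  · refine h.uncommon_of_pairwiseIndep hind h2 (fun h3 => ?_) e h₁ h₂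
    -- In characteristic `3` the first and fourth terms of a progression coincide.
    have : φ (e 0) = φ (e 3) := LinearMap.ext fun w => by
      linear_combination h₁ w - h₂ w + (φ (e 1) w - φ (e 2) w) * h3
    exact absurd (e.injective (hφ this)) (by decide)
  · simp only [PairwiseIndep] at hind
    push Not at hind
    obtain ⟨i, j, hij, hw⟩ := hind
    obtain ⟨c, hc⟩ := exists_eq_smul_of_forall_apply_eq_zero (α := φ j) (β := φ i) fun w hj => by
      by_contra hi
      exact hw ((φ i w)⁻¹ • w) (by simp [hi]) (by simp [hj])
    exact h.uncommon_of_eq_smul hφ h0 hij hc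

end FourTerm

/-! ### Parametrising the solutions of concrete systems. -/

section Systems

variable {F : Type*} [Field F]

lemma apSystem_mulVec (l : ℕ) (z : Fin l → F) (r : Fin (l - 2)) :
    (apSystem F l).mulVec z r =
      z ⟨r, by omega⟩ - 2 * z ⟨r + 1, by omega⟩ + z ⟨r + 2, by omega⟩ := by
  have h : ∀ c : Fin l, apSystem F l r c = (if c = ⟨r, by omega⟩ then 1 else 0) +
      (if c = ⟨r + 1, by omega⟩ then -2 else 0) + if c = ⟨r + 2, by omega⟩ then 1 else 0 := by
    intro c
    simp only [apSystem, Matrix.of_apply, Fin.ext_iff]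
    split_ifs <;> first | omega | simp
  simp only [Matrix.mulVec, dotProduct, h, add_mul, Finset.sum_add_distrib, ite_mul, zero_mul,
    Finset.sum_ite_eq', Finset.mem_univ, if_true]
  ring

lemma apSystem_mulVec_eq_zero_iff {l : ℕ} (hl : 2 ≤ l) (z : Fin l → F) :
    (apSystem F l).mulVec z = 0 ↔
      ∀ i : Fin l, z i = z ⟨0, by omega⟩ + i * (z ⟨1, by omega⟩ - z ⟨0, by omega⟩) := by
  constructor
  · intro h
    have key : ∀ i : ℕ, ∀ hi : i + 1 < l,
        z ⟨i, by omega⟩ = z ⟨0, by omega⟩ + i * (z ⟨1, by omega⟩ - z ⟨0, by omega⟩) ∧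
        z ⟨i + 1, hi⟩ =
          z ⟨0, by omega⟩ + (i + 1 : ℕ) * (z ⟨1, by omega⟩ - z ⟨0, by omega⟩) := by
      intro i
      induction i with
      | zero => intro _; simp
      | succ i ih =>
        intro hi
        obtain ⟨h1, h2⟩ := ih (by omega)
        refine ⟨h2, ?_⟩
        have h3 := congrFun h ⟨i, by omega⟩
        rw [apSystem_mulVec, Pi.zero_apply] at h3
        simp only at h3
        rw [h1, h2] at h3
        push_cast at h3 ⊢
        linear_combination h3
    rintro ⟨i, hi⟩
    rcases i with _ | i
    · simp
    · exact (key i hi).2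
  · intro h
    ext r
    rw [apSystem_mulVec, h ⟨r, _⟩, h ⟨r + 1, _⟩, h ⟨r + 2, _⟩, Pi.zero_apply]
    push_cast
    ring

lemma Induces.apSystem_of_le {m k l l' : ℕ} {L : Matrix (Fin m) (Fin k) F} (hl : l' ≤ l)
    (hl' : 2 ≤ l') (h : Induces L (apSystem F l)) : Induces L (apSystem F l') := by
  obtain ⟨i, hi⟩ := h
  refine ⟨(Fin.castLEEmb hl).trans i, fun x hx => ?_⟩
  have := (apSystem_mulVec_eq_zero_iff (hl'.trans hl) _).1 (hi x hx)
  exact (apSystem_mulVec_eq_zero_iff hl' _).2 fun t => this (Fin.castLE hl t)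

variable [Fintype F] [DecidableEq F]

lemma mem_sol_iff {m k n : ℕ} {L : Matrix (Fin m) (Fin k) F} {A : Finset (Fin n → F)}
    {x : Fin k → Fin n → F} :
    x ∈ sol L A ↔ (∀ i, x i ∈ A) ∧ ∀ t, L.mulVec (fun i => x i t) = 0 := by
  simp only [sol, Finset.mem_filter, Finset.mem_univ, true_and]
  refine and_congr_right fun _ => ⟨fun h t => ?_, fun h r => ?_⟩
  · ext r
    simpa [Matrix.mulVec, dotProduct] using congrFun (h r) t
  · ext t
    simpa [Matrix.mulVec, dotProduct] using congrFun (h t) r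

lemma represents_ker {m k : ℕ} (L : Matrix (Fin m) (Fin k) F)
    [Fintype (LinearMap.ker L.mulVecLin)] :
    Represents L fun i => (LinearMap.proj i : (Fin k → F) →ₗ[F] F) ∘ₗ
      (LinearMap.ker L.mulVecLin).subtype := by
  intro n A
  refine Finset.card_bij' (fun x hx t => ⟨fun i => x i t, by simpa using (mem_sol_iff.1 hx).2 t⟩)
    (fun y _ i t => (y t).1 i) (fun x hx => ?_) (fun y hy => ?_) (fun x hx => rfl) (fun y hy => rfl)
  · exact (@Finset.mem_filter _ _ (_) _ _).2 ⟨Finset.mem_univ _, (mem_sol_iff.1 hx).1⟩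
  · have hy := ((@Finset.mem_filter _ _ (_) _ _).1 hy).2
    exact mem_sol_iff.2 ⟨hy, fun t => LinearMap.mem_ker.1 (y t).2⟩

theorem uncommon_of_induces_apSystem_four (h2 : (2 : F) ≠ 0) {m k : ℕ}
    {L : Matrix (Fin m) (Fin k) F} (hirr : Irredundant L) (hap : Induces L (apSystem F 4)) :
    Uncommon L := by
  classical
  obtain ⟨e, he⟩ := hap
  have : Fintype (LinearMap.ker L.mulVecLin) := Fintype.ofFinite _
  have hrow : ∀ (w : LinearMap.ker L.mulVecLin) (r : Fin 2), _ := fun w r =>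
    (apSystem_mulVec 4 _ r).symm.trans (congrFun (he w.1 (LinearMap.mem_ker.1 w.2)) r)
  refine (represents_ker L).uncommon_of_fourTerm (fun i j hij => ?_) h2 e (fun w => hrow w 0)
    fun w => hrow w 1
  by_contra hne
  refine hirr ⟨i, j, hne, fun x hx => sub_eq_zero.2 ?_⟩
  exact LinearMap.congr_fun hij ⟨x, by simpa using hx⟩

/-- The form `(a, d) ↦ a + j * d`. -/
def apForm (F : Type*) [Field F] (j : ℕ) : F × F →ₗ[F] F :=
  LinearMap.fst F F F + (j : F) • LinearMap.snd F F F

omit [Fintype F] [DecidableEq F] in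
lemma apForm_apply (j : ℕ) (w : F × F) : apForm F j w = w.1 + j * w.2 := rfl

/-- The terms of a progression repeat with period `p`, so only the first `min l p` forms are kept.
This makes the family injective even though the `l`-AP is redundant when `l > p`. -/
lemma represents_apForm {l p : ℕ} [CharP F p] (hl : 2 ≤ l) (hp : 0 < p) :
    Represents (apSystem F l) fun j : Fin (min l p) => apForm F j := by
  intro n A
  have hmod : ∀ (i : ℕ) (w : F × F), apForm F (i % p) w = apForm F i w := fun i w => by
    rw [apForm_apply, apForm_apply, CharP.cast_eq_mod F p (i % p), Nat.mod_mod,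
      ← CharP.cast_eq_mod F p i]
  have hsol : ∀ x ∈ sol (apSystem F l) A, ∀ (i : Fin l) t,
      x i t = apForm F i (x ⟨0, by omega⟩ t, x ⟨1, by omega⟩ t - x ⟨0, by omega⟩ t) :=
    fun x hx i t => (apSystem_mulVec_eq_zero_iff hl _).1 ((mem_sol_iff.1 hx).2 t) i
  refine Finset.card_bij'
    (fun x _ t => (x ⟨0, by omega⟩ t, x ⟨1, by omega⟩ t - x ⟨0, by omega⟩ t))
    (fun y _ i t => apForm F i (y t)) (fun x hx => ?_) (fun y hy => ?_) (fun x hx => ?_)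
    (fun y hy => ?_)
  · simp only [Finset.mem_filter, Finset.mem_univ, true_and]
    intro j
    have := (mem_sol_iff.1 hx).1 ⟨j, by omega⟩
    rwa [funext (hsol x hx ⟨j, by omega⟩)] at this
  · simp only [Finset.mem_filter, Finset.mem_univ, true_and] at hy
    refine mem_sol_iff.2 ⟨fun i => ?_, fun t => ?_⟩
    · have := hy ⟨i % p, lt_min ((Nat.mod_le _ _).trans_lt i.2) (Nat.mod_lt _ hp)⟩
      simpa only [hmod] using this
    · refine (apSystem_mulVec_eq_zero_iff hl _).2 fun i => ?_
      simp [apForm_apply]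
  · ext i t
    exact (hsol x hx i t).symm
  · ext t <;> simp [apForm_apply]

theorem uncommon_apSystem (h2 : (2 : F) ≠ 0) (h3 : (3 : F) ≠ 0) {l : ℕ} (hl : 4 ≤ l) :
    Uncommon (apSystem F l) := by
  obtain ⟨p, hp⟩ := CharP.exists F
  have hprime : p.Prime := CharP.char_is_prime F p
  -- With `2` and `3` nonzero in `F`, the characteristic leaves room for four distinct terms.
  have hp4 : 4 ≤ p := by
    by_contra! hlt
    have h := CharP.cast_eq_zero F p
    have := hprime.two_le
    interval_cases p
    · exact h2 (by exact_mod_cast h)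
    · exact h3 (by exact_mod_cast h)
  refine (represents_apForm (l := l) (p := p) (by omega) hprime.pos).uncommon_of_fourTerm
    (fun i j hij => ?_) h2 (Fin.castLEEmb (le_min hl hp4)) (fun w => ?_) (fun w => ?_)
  · have h := LinearMap.congr_fun hij (0, 1)
    simp only [apForm_apply, zero_add, mul_one] at h
    exact Fin.ext (CharP.natCast_injOn_Iio F p (i.2.trans_le (min_le_right _ _))
      (j.2.trans_le (min_le_right _ _)) h)
  all_goals
    simp [apForm_apply]
    ring

end Systems

end LinSystem

theorem corollary1p2 {F : Type*} [Field F] [Fintype F] [DecidableEq F]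
    (hq : Odd (Fintype.card F)) :
    (∀ (m k : ℕ) (L : Matrix (Fin m) (Fin k) F), 2 ≤ m → m < k →
        LinSystem.IsSystem L → LinSystem.Irredundant L →
        LinSystem.Induces L (LinSystem.apSystem F 4) → LinSystem.Uncommon L) ∧
    (∀ (l m k : ℕ) (L : Matrix (Fin m) (Fin k) F), 4 ≤ l → 2 ≤ m → m < k →
        LinSystem.IsSystem L → LinSystem.Irredundant L →
        LinSystem.Induces L (LinSystem.apSystem F l) → LinSystem.Uncommon L) ∧
    (∀ l : ℕ, 4 ≤ l → (3 : F) ≠ 0 → LinSystem.Uncommon (LinSystem.apSystem F l)) := by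
  have h2 : (2 : F) ≠ 0 := Ring.two_ne_zero fun h => by
    have := FiniteField.even_card_of_char_two h
    rw [← Nat.even_iff] at this
    exact (Nat.not_even_iff_odd.2 hq) this
  exact ⟨fun _ _ _ _ _ _ hirr hap => LinSystem.uncommon_of_induces_apSystem_four h2 hirr hap,
    fun _ _ _ _ hl _ _ _ hirr hap => LinSystem.uncommon_of_induces_apSystem_four h2 hirr
      (hap.apSystem_of_le hl (by norm_num)),
    fun _ hl h3 => LinSystem.uncommon_apSystem h2 h3 hl⟩
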